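/- Let $(X,Y)$ be a pair of real random variables with law $R$ and marginal laws $P=\mathcal L(X)$, $Q=\mathcal L(Y)$, and suppose that $R$ is totally positive of order two (TP2): for all Borel sets $A_1<A_2$ and $B_1<B_2$ (element-wise), $$R(A_2\times B_1)\,R(A_1\times B_2)\ \le\ R(A_1\times B_1)\,R(A_2\times B_2).$$ Put $\mathcal X=\{x\in\mathbb R:\Pr(X\le x)>0,\ \Pr(X\ge x)>0\}$ and, for $x\in\mathbb R$, $$S^{\rm nw}(x)=\min\{y\in[-\infty,\infty]:\Pr(X\le x,\,Y>y)=0\},\qquad S^{\rm se}(x)=\max\{y\in[-\infty,\infty]:\Pr(X\ge x,\,Y<y)=0\},$$ and let $\mathcal X_o=\{x\in\mathcal X: S^{\rm nw}(x)\le S^{\rm se}(x)\}$. For probability measures on $\mathbb R$ write $Q_1\le_{\rm lr}Q_2$ if $Q_1,Q_2$ have densities $g_1,g_2$ with respect to some $\sigma$-finite measure such that $g_2/g_1$ is isotonic (non-decreasing, with values in $[0,\infty]$) on $\{g_1+g_2>0\}$. There exist isotonic functions $S:\mathcal X_o\to\mathbb R$ with $S^{\rm nw}\le S\le S^{\rm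 se}$ on $\mathcal X_o$, and for every such $S$ there is a stochastic kernel $K$ from $\mathbb R$ to $\mathbb R$ with $R(A\times B)=\int_A K(x,B)\,P(dx)$ for all Borel sets $A,B$, such that $K(x_1,\cdot)\le_{\rm lr}K(x_2,\cdot)$ for all $x_1<x_2$ in $\mathcal X$, and: (a) if $x\in\mathcal X_o$, then $K(x,\cdot)=\delta_{S(x)}$; (b) if $x\in\mathcal X\setminus\mathcal X_o$, then $K(x,\cdot)$ has a bounded density $h(x,\cdot)\ge 0$ with respect to $Q$ (the bound may depend on $x$) such that $h(x,y)=0$ whenever $y<S^{\rm se}(x)$ or $y>S^{\rm nw}(x)$. Moreover, $h$ is TP2 on $(\mathcal X\setminus\mathcal X_o)\times\mathbb R$: for all $x_1<x_2$ in $\mathcal X\setminus\mathcal X_o$ and all real $y_1<y_2$, $$h(x_2,y_1)\,h(x_1,y_2)\ \le\ h(x_1,y_1)\,h(x_2,y_2).$$ -/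

import Mathlib

open MeasureTheory ProbabilityTheory Set
open scoped ENNReal NNReal

namespace TP2Law

/-- Likelihood ratio order `Q₁ ≤_lr Q₂`: with respect to some σ-finite measure `μ` the two
distributions have (finite, nonnegative) densities `g₁`, `g₂` such that `g₂ / g₁` is isotonic on
`{g₁ + g₂ > 0}`.  The ratio is taken in `[0, ∞]`, so that `c / 0 = ∞` for `c > 0`. -/
def LRLe (Q₁ Q₂ : Measure ℝ) : Prop :=
  ∃ (μ : Measure ℝ) (g₁ g₂ : ℝ → ℝ≥0), SigmaFinite μ ∧ Measurable g₁ ∧ Measurable g₂ ∧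
    Q₁ = μ.withDensity (fun y => (g₁ y : ℝ≥0∞)) ∧
    Q₂ = μ.withDensity (fun y => (g₂ y : ℝ≥0∞)) ∧
    MonotoneOn (fun y => (g₂ y : ℝ≥0∞) / (g₁ y : ℝ≥0∞)) {y | 0 < g₁ y + g₂ y}

/-- `A < B` element-wise. -/
def SetLT (A B : Set ℝ) : Prop := ∀ a ∈ A, ∀ b ∈ B, a < b

/-- Total positivity of order two of a distribution `R` on `ℝ × ℝ`. -/
def IsTP2Measure (R : Measure (ℝ × ℝ)) : Prop :=
  ∀ A₁ A₂ B₁ B₂ : Set ℝ, MeasurableSet A₁ → MeasurableSet A₂ → MeasurableSet B₁ →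
    MeasurableSet B₂ → SetLT A₁ A₂ → SetLT B₁ B₂ →
    R (A₂ ×ˢ B₁) * R (A₁ ×ˢ B₂) ≤ R (A₁ ×ˢ B₁) * R (A₂ ×ˢ B₂)

/-- A function `h` is TP2 on `D × ℝ`. -/
def IsTP2On (D : Set ℝ) (h : ℝ → ℝ → ℝ) : Prop :=
  ∀ x₁ ∈ D, ∀ x₂ ∈ D, x₁ < x₂ → ∀ y₁ y₂ : ℝ, y₁ < y₂ →
    h x₂ y₁ * h x₁ y₂ ≤ h x₁ y₁ * h x₂ y₂

/-- The range of the first coordinate: all `x` with `P(X ≤ x) > 0` and `P(X ≥ x) > 0`. -/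
def xRange (R : Measure (ℝ × ℝ)) : Set ℝ :=
  {x | 0 < R {p | p.1 ≤ x} ∧ 0 < R {p | x ≤ p.1}}

/-- The northwest boundary: the least `y ∈ [-∞, ∞]` with `P(X ≤ x, Y > y) = 0`
(the infimum is attained, see `isLeast_nw`). -/
noncomputable def nw (R : Measure (ℝ × ℝ)) (x : ℝ) : EReal :=
  sInf {y : EReal | R {p | p.1 ≤ x ∧ y < (p.2 : EReal)} = 0}

/-- The southeast boundary: the greatest `y ∈ [-∞, ∞]` with `P(X ≥ x, Y < y) = 0`
(the supremum is attained, see `isGreatest_se`). -/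
noncomputable def se (R : Measure (ℝ × ℝ)) (x : ℝ) : EReal :=
  sSup {y : EReal | R {p | x ≤ p.1 ∧ (p.2 : EReal) < y} = 0}

theorem isLeast_nw (R : Measure (ℝ × ℝ)) (x : ℝ) :
    IsLeast {y : EReal | R {p | p.1 ≤ x ∧ y < (p.2 : EReal)} = 0} (nw R x) := by
  refine ⟨?_, fun y hy => sInf_le hy⟩
  have hne : {y : EReal | R {p | p.1 ≤ x ∧ y < (p.2 : EReal)} = 0}.Nonempty := ⟨⊤, by simp⟩
  obtain ⟨u, -, hu, huT⟩ := exists_seq_tendsto_sInf hne (OrderBot.bddBelow _)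
  refine measure_mono_null (t := ⋃ n, {p : ℝ × ℝ | p.1 ≤ x ∧ u n < (p.2 : EReal)}) ?_
    (measure_iUnion_null huT)
  rintro p ⟨hp1, hp2⟩
  obtain ⟨n, hn⟩ := (hu.eventually_lt_const hp2).exists
  exact mem_iUnion.2 ⟨n, hp1, hn⟩

theorem isGreatest_se (R : Measure (ℝ × ℝ)) (x : ℝ) :
    IsGreatest {y : EReal | R {p | x ≤ p.1 ∧ (p.2 : EReal) < y} = 0} (se R x) := by
  refine ⟨?_, fun y hy => le_sSup hy⟩
  have hne : {y : EReal | R {p | x ≤ p.1 ∧ (p.2 : EReal) < y} = 0}.Nonempty := ⟨⊥, by simp⟩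
  obtain ⟨u, -, hu, huT⟩ := exists_seq_tendsto_sSup hne (OrderTop.bddAbove _)
  refine measure_mono_null (t := ⋃ n, {p : ℝ × ℝ | x ≤ p.1 ∧ (p.2 : EReal) < u n}) ?_
    (measure_iUnion_null huT)
  rintro p ⟨hp1, hp2⟩
  obtain ⟨n, hn⟩ := (hu.eventually_const_lt hp2).exists
  exact mem_iUnion.2 ⟨n, hp1, hn⟩

/-- The set `𝒳_o` of all `x` in the range of `X` with `S^nw(x) ≤ S^se(x)`. -/
def xo (R : Measure (ℝ × ℝ)) : Set ℝ := {x | x ∈ xRange R ∧ nw R x ≤ se R x}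

/-- An isotonic function `S : 𝒳_o → ℝ` with `S^nw ≤ S ≤ S^se` on `𝒳_o`. -/
def IsIsotonicSelection (R : Measure (ℝ × ℝ)) (S : xo R → ℝ) : Prop :=
  Monotone S ∧ ∀ x : xo R, nw R x ≤ ((S x : ℝ) : EReal) ∧ ((S x : ℝ) : EReal) ≤ se R x

end TP2Law

namespace TP2Law

open Filter Topology Metric

/-! ### Limits along an ultrafilter converging to zero from the right -/

/-! A conditional law is determined only up to `R.fst`-null sets, while the order and the density
are required at every point of the range. So the law at `z` is defined pointwise, as the limit of `R
(I ×ˢ B) / R.fst I` over intervals `I` shrinking to `z`, along one fixed ultrafilter so that every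
limit exists. Such limits inherit finite additivity and the TP2 inequality.

If `se R x < nw R x`, some real `y` lies strictly between, and both quadrants `Iic x ×ˢ Ioi y` and
`Ici x ×ˢ Iio y` have mass. TP2 against these quadrants bounds the limit by a multiple of `R.snd`
(`IsTP2Measure.condLim_le`); this gives countable additivity and a bounded density. Taking that
density by the same ultrafilter limit makes it TP2 at all points; its measurability comes from
monotone density ratios (`measurable_dens`).

Gaps in the support of the first marginal are filled with the law at the next support point.
Truncation to the window between the boundaries keeps TP2 because both boundaries increase. As `R`
lives between the boundaries, truncation changes almost no law, and on `xo R` the conditional law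
must be the point mass. Besicovitch differentiation identifies the result with `condKernel`, and the
likelihood ratio order makes distribution functions antitone in `x`, hence the kernel measurable. -/

/-- A fixed ultrafilter converging to `0` from the right. -/
noncomputable def rightUltrafilter : Ultrafilter ℝ := Ultrafilter.of (𝓝[>] (0 : ℝ))

theorem rightUltrafilter_le : (rightUltrafilter : Filter ℝ) ≤ 𝓝[>] (0 : ℝ) :=
  Ultrafilter.of_le _

/-- The limit of an extended nonnegative function along `rightUltrafilter`; it always exists. -/
noncomputable def ulim (f : ℝ → ℝ≥0∞) : ℝ≥0∞ := (rightUltrafilter.map f).lim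

/-- `[0, ∞]` is compact, so every ultrafilter on it converges. -/
theorem tendsto_ulim (f : ℝ → ℝ≥0∞) : Tendsto f rightUltrafilter (𝓝 (ulim f)) :=
  (rightUltrafilter.map f).le_nhds_lim

theorem ulim_eq {f : ℝ → ℝ≥0∞} {a : ℝ≥0∞} (h : Tendsto f rightUltrafilter (𝓝 a)) :
    ulim f = a :=
  tendsto_nhds_unique (tendsto_ulim f) h

theorem ulim_eq_of_tendsto {f : ℝ → ℝ≥0∞} {a : ℝ≥0∞} (h : Tendsto f (𝓝[>] 0) (𝓝 a)) :
    ulim f = a :=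
  ulim_eq (h.mono_left rightUltrafilter_le)

theorem ulim_le {f : ℝ → ℝ≥0∞} {a : ℝ≥0∞} (h : ∀ r, f r ≤ a) : ulim f ≤ a :=
  le_of_tendsto (tendsto_ulim f) (Eventually.of_forall h)

/-- Finite limits avoid `0 * ∞`, where multiplication is discontinuous. -/
theorem mul_le_mul_of_tendsto {ι : Type*} {l : Filter ι} [l.NeBot] {f₁ f₂ f₃ f₄ : ι → ℝ≥0∞}
    {a₁ a₂ a₃ a₄ : ℝ≥0∞} (h₁ : Tendsto f₁ l (𝓝 a₁)) (h₂ : Tendsto f₂ l (𝓝 a₂))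
    (h₃ : Tendsto f₃ l (𝓝 a₃)) (h₄ : Tendsto f₄ l (𝓝 a₄)) (n₁ : a₁ ≠ ∞) (n₂ : a₂ ≠ ∞)
    (n₃ : a₃ ≠ ∞) (n₄ : a₄ ≠ ∞) (h : ∀ᶠ i in l, f₁ i * f₂ i ≤ f₃ i * f₄ i) :
    a₁ * a₂ ≤ a₃ * a₄ :=
  le_of_tendsto_of_tendsto (ENNReal.Tendsto.mul h₁ (.inr n₂) h₂ (.inr n₁))
    (ENNReal.Tendsto.mul h₃ (.inr n₄) h₄ (.inr n₃)) h

/-! ### The likelihood ratio order for set functions -/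

/-- Likelihood ratio order for set functions, in terms of ordered pairs of sets. -/
def SetLR (m₁ m₂ : Set ℝ → ℝ≥0∞) : Prop :=
  ∀ B₁ B₂ : Set ℝ, MeasurableSet B₁ → MeasurableSet B₂ → SetLT B₁ B₂ →
    m₂ B₁ * m₁ B₂ ≤ m₁ B₁ * m₂ B₂

theorem SetLT.disjoint {A B : Set ℝ} (h : SetLT A B) : Disjoint A B :=
  Set.disjoint_left.2 fun a ha hb => lt_irrefl a (h a ha a hb)

theorem setLT_closedBall {x y r : ℝ} (h : 2 * r < y - x) :
    SetLT (closedBall x r) (closedBall y r) := by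
  intro a ha b hb
  rw [Real.closedBall_eq_Icc] at ha hb
  linarith [ha.2, hb.1]

theorem eventually_setLT_closedBall {x y : ℝ} (h : x < y) :
    ∀ᶠ r in (rightUltrafilter : Filter ℝ), SetLT (closedBall x r) (closedBall y r) := by
  apply rightUltrafilter_le
  have : Iio ((y - x) / 2) ∈ 𝓝[>] (0 : ℝ) :=
    mem_nhdsWithin_of_mem_nhds (Iio_mem_nhds (by linarith))
  filter_upwards [this] with r hr
  exact setLT_closedBall (by rw [mem_Iio] at hr; linarith)

/-- TP2 for the pairs `(C, I)`, `(I, D)`, `(C, D)` controls three of the four products; the `I`-`I`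
product is common to both sides. This allows comparison of overlapping sets such as half-lines. -/
theorem IsTP2Measure.setLR_union {R : Measure (ℝ × ℝ)} (hR : IsTP2Measure R) {C I D : Set ℝ}
    (hC : MeasurableSet C) (hI : MeasurableSet I) (hD : MeasurableSet D) (hCI : SetLT C I)
    (hID : SetLT I D) (hCD : SetLT C D) :
    SetLR (fun B => R ((C ∪ I) ×ˢ B)) (fun B => R ((I ∪ D) ×ˢ B)) := by
  intro B₁ B₂ h₁ h₂ h
  have key : ∀ {A A' : Set ℝ}, SetLT A A' → MeasurableSet A' → ∀ {B : Set ℝ}, MeasurableSet B →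
      R ((A ∪ A') ×ˢ B) = R (A ×ˢ B) + R (A' ×ˢ B) := by
    intro A A' hA hA' B hB
    rw [Set.union_prod, measure_union (Set.disjoint_prod.2 (.inl hA.disjoint)) (hA'.prod hB)]
  simp only [key hCI hI h₁, key hCI hI h₂, key hID hD h₁, key hID hD h₂]
  have e₁ := hR C I B₁ B₂ hC hI h₁ h₂ hCI h
  have e₂ := hR I D B₁ B₂ hI hD h₁ h₂ hID h
  have e₃ := hR C D B₁ B₂ hC hD h₁ h₂ hCD h
  set c₁ := R (C ×ˢ B₁)
  set c₂ := R (C ×ˢ B₂)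
  set i₁ := R (I ×ˢ B₁)
  set i₂ := R (I ×ˢ B₂)
  set d₁ := R (D ×ˢ B₁)
  set d₂ := R (D ×ˢ B₂)
  calc (i₁ + d₁) * (c₂ + i₂) = i₁ * c₂ + d₁ * i₂ + d₁ * c₂ + i₁ * i₂ := by ring
    _ ≤ c₁ * i₂ + i₁ * d₂ + c₁ * d₂ + i₁ * i₂ := by gcongr
    _ = (c₁ + i₁) * (i₂ + d₂) := by ring

theorem SetLR.div {m₁ m₂ : Set ℝ → ℝ≥0∞} (h : SetLR m₁ m₂) (c d : ℝ≥0∞) :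
    SetLR (fun B => m₁ B / c) (fun B => m₂ B / d) := by
  intro B₁ B₂ h₁ h₂ hB
  simp only [div_eq_mul_inv]
  calc m₂ B₁ * d⁻¹ * (m₁ B₂ * c⁻¹) = m₂ B₁ * m₁ B₂ * (c⁻¹ * d⁻¹) := by ring
    _ ≤ m₁ B₁ * m₂ B₂ * (c⁻¹ * d⁻¹) := mul_le_mul_left (h B₁ B₂ h₁ h₂ hB) _
    _ = m₁ B₁ * c⁻¹ * (m₂ B₂ * d⁻¹) := by ring

/-! ### Densities as pointwise limits of quotients -/

/-- A pointwise defined density of `μ` with respect to `Q`. -/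
noncomputable def dens (μ Q : Measure ℝ) (y : ℝ) : ℝ≥0∞ :=
  ulim fun r => μ (closedBall y r) / Q (closedBall y r)

section Dens

variable {μ ν L U Q : Measure ℝ} {C : ℝ≥0∞}

theorem dens_le (h : ∀ s, MeasurableSet s → μ s ≤ C * Q s) (y : ℝ) : dens μ Q y ≤ C :=
  ulim_le fun _ => ENNReal.div_le_of_le_mul (h _ measurableSet_closedBall)

theorem dens_ne_top (hC : C ≠ ∞) (h : ∀ s, MeasurableSet s → μ s ≤ C * Q s) (y : ℝ) :
    dens μ Q y ≠ ∞ :=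
  ((dens_le h y).trans_lt hC.lt_top).ne

theorem dens_mul_le (hμ : ∀ y, dens μ Q y ≠ ∞) (hν : ∀ y, dens ν Q y ≠ ∞)
    (h : SetLR (fun s => μ s) (fun s => ν s)) {y₁ y₂ : ℝ} (hy : y₁ < y₂) :
    dens ν Q y₁ * dens μ Q y₂ ≤ dens μ Q y₁ * dens ν Q y₂ := by
  refine mul_le_mul_of_tendsto (tendsto_ulim _) (tendsto_ulim _) (tendsto_ulim _) (tendsto_ulim _)
    (hν _) (hμ _) (hμ _) (hν _) ?_
  filter_upwards [eventually_setLT_closedBall hy] with r hr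
  have := h _ _ measurableSet_closedBall measurableSet_closedBall hr
  simp only [div_eq_mul_inv]
  calc _ = ν (closedBall y₁ r) * μ (closedBall y₂ r) *
        ((Q (closedBall y₁ r))⁻¹ * (Q (closedBall y₂ r))⁻¹) := by ring
    _ ≤ μ (closedBall y₁ r) * ν (closedBall y₂ r) *
        ((Q (closedBall y₁ r))⁻¹ * (Q (closedBall y₂ r))⁻¹) := by gcongr
    _ = _ := by ring

theorem eventually_measure_closedBall_eq_zero {y : ℝ} (hy : y ∉ Q.support) :
    ∀ᶠ r in (rightUltrafilter : Filter ℝ), Q (closedBall y r) = 0 := by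
  apply rightUltrafilter_le
  obtain ⟨V, hV, hV0⟩ := Measure.notMem_support_iff_exists.1 hy
  obtain ⟨ε, hε, hεV⟩ := Metric.nhds_basis_closedBall.mem_iff.1 hV
  have : Iio ε ∈ 𝓝[>] (0 : ℝ) := mem_nhdsWithin_of_mem_nhds (Iio_mem_nhds hε)
  filter_upwards [this] with r hr
  exact measure_mono_null ((closedBall_subset_closedBall (le_of_lt hr)).trans hεV) hV0

theorem eventually_measure_closedBall_pos {y : ℝ} (hy : y ∈ Q.support) :
    ∀ᶠ r in (rightUltrafilter : Filter ℝ), 0 < Q (closedBall y r) := by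
  apply rightUltrafilter_le
  filter_upwards [self_mem_nhdsWithin] with r hr
  exact (Measure.mem_support_iff_forall y).1 hy _ (closedBall_mem_nhds y hr)

theorem dens_eq_zero_of_notMem_support (h : ∀ s, MeasurableSet s → μ s ≤ C * Q s) {y : ℝ}
    (hy : y ∉ Q.support) : dens μ Q y = 0 := by
  refine ulim_eq (tendsto_const_nhds.congr' ?_)
  filter_upwards [eventually_measure_closedBall_eq_zero hy] with r hr
  have := h _ (measurableSet_closedBall (x := y) (ε := r))
  rw [hr, mul_zero, nonpos_iff_eq_zero] at this
  simp [this]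

theorem dens_self [IsFiniteMeasure Q] {y : ℝ} (hy : y ∈ Q.support) : dens Q Q y = 1 := by
  refine ulim_eq (tendsto_const_nhds.congr' ?_)
  filter_upwards [eventually_measure_closedBall_pos hy] with r hr
  exact (ENNReal.div_self hr.ne' (measure_ne_top _ _)).symm

/-- Ensures that at each support point one of the two densities is nonzero and can serve as a
denominator. -/
theorem one_le_dens_add_dens [IsFiniteMeasure Q] (h : ∀ s, MeasurableSet s → Q s ≤ L s + U s)
    {y : ℝ} (hy : y ∈ Q.support) : 1 ≤ dens L Q y + dens U Q y := by
  refine ge_of_tendsto ((tendsto_ulim _).add (tendsto_ulim _)) ?_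
  filter_upwards [eventually_measure_closedBall_pos hy] with r hr
  rw [← ENNReal.add_div, ← ENNReal.div_self hr.ne' (measure_ne_top Q _)]
  gcongr
  exact h _ measurableSet_closedBall

theorem dens_ae_eq_rnDeriv [IsFiniteMeasure Q] [IsFiniteMeasure μ] :
    dens μ Q =ᵐ[Q] μ.rnDeriv Q := by
  filter_upwards [Besicovitch.ae_tendsto_rnDeriv μ Q] with y hy
  exact ulim_eq_of_tendsto hy

theorem withDensity_dens [IsFiniteMeasure Q] [IsFiniteMeasure μ]
    (h : ∀ s, MeasurableSet s → μ s ≤ C * Q s) : Q.withDensity (dens μ Q) = μ := by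
  rw [withDensity_congr_ae dens_ae_eq_rnDeriv]
  refine Measure.withDensity_rnDeriv_eq _ _ (Measure.AbsolutelyContinuous.mk fun s hs h0 => ?_)
  simpa [h0] using h s hs

theorem measurable_of_monotoneOn {T : Set ℝ} {f : ℝ → ℝ≥0∞}
    (hf : MonotoneOn f T) : Measurable (T.domRestrict f) :=
  Monotone.measurable fun a b hab => hf a.2 b.2 hab

theorem measurable_of_antitoneOn {T : Set ℝ} {f : ℝ → ℝ≥0∞}
    (hf : AntitoneOn f T) : Measurable (T.domRestrict f) :=
  Antitone.measurable fun a b hab => hf a.2 b.2 hab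

theorem monotoneOn_div {f g : ℝ → ℝ≥0∞} {T : Set ℝ} (hf : ∀ y, f y ≠ ∞)
    (hT : ∀ y ∈ T, f y ≠ 0)
    (h : ∀ y₁ y₂, y₁ < y₂ → g y₁ * f y₂ ≤ f y₁ * g y₂) : MonotoneOn (fun y => g y / f y) T := by
  intro a ha b hb hab
  rcases hab.eq_or_lt with rfl | hab
  · exact le_rfl
  · have := h a b hab
    show g a / f a ≤ g b / f b
    rw [ENNReal.div_le_iff (hT a ha) (hf a), div_eq_mul_inv, mul_right_comm, ← div_eq_mul_inv,
      ENNReal.le_div_iff_mul_le (.inl (hT b hb)) (.inl (hf b)), mul_comm (g b)]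
    exact this

theorem antitoneOn_div {f g : ℝ → ℝ≥0∞} {T : Set ℝ} (hf : ∀ y, f y ≠ ∞)
    (hT : ∀ y ∈ T, f y ≠ 0)
    (h : ∀ y₁ y₂, y₁ < y₂ → f y₁ * g y₂ ≤ g y₁ * f y₂) : AntitoneOn (fun y => g y / f y) T := by
  intro a ha b hb hab
  rcases hab.eq_or_lt with rfl | hab
  · exact le_rfl
  · have := h a b hab
    show g b / f b ≤ g a / f a
    rw [ENNReal.div_le_iff (hT b hb) (hf b), div_eq_mul_inv, mul_right_comm, ← div_eq_mul_inv,
      ENNReal.le_div_iff_mul_le (.inl (hT a ha)) (.inl (hf a)), mul_comm (g b)]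
    exact this

theorem measurable_of_restrict_div {f g : ℝ → ℝ≥0∞} {T : Set ℝ} (hfm : Measurable f)
    (hf : ∀ y, f y ≠ ∞) (hT : ∀ y ∈ T, f y ≠ 0)
    (h : Measurable (T.domRestrict fun y => g y / f y)) : Measurable (T.domRestrict g) := by
  have : T.domRestrict g = fun y => T.domRestrict (fun y => g y / f y) y * T.domRestrict f y := by
    funext y
    simp only [Set.domRestrict_apply]
    rw [ENNReal.div_mul_cancel (hT y y.2) (hf y)]
  rw [this]
  exact h.mul (hfm.comp measurable_subtype_coe)

/-- The pointwise density of a measure between `L` and `U` in likelihood ratio order is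
measurable. -/
theorem measurable_dens [IsFiniteMeasure Q]
    (hC : C ≠ ∞) (hμ : ∀ s, MeasurableSet s → μ s ≤ C * Q s)
    (hL : ∀ s, MeasurableSet s → L s ≤ Q s) (hU : ∀ s, MeasurableSet s → U s ≤ Q s)
    (hLU : ∀ s, MeasurableSet s → Q s ≤ L s + U s)
    (hLQ : SetLR (fun s => L s) (fun s => Q s)) (hQU : SetLR (fun s => Q s) (fun s => U s))
    (hLμ : SetLR (fun s => L s) (fun s => μ s)) (hμU : SetLR (fun s => μ s) (fun s => U s)) :
    Measurable (dens μ Q) := by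
  have hL' : ∀ s, MeasurableSet s → L s ≤ 1 * Q s := by simpa using hL
  have hU' : ∀ s, MeasurableSet s → U s ≤ 1 * Q s := by simpa using hU
  have hQ' : ∀ s, MeasurableSet s → Q s ≤ 1 * Q s := by simp
  have tL := dens_ne_top ENNReal.one_ne_top hL'
  have tU := dens_ne_top ENNReal.one_ne_top hU'
  have tQ := dens_ne_top ENNReal.one_ne_top hQ'
  have tμ := dens_ne_top hC hμ
  have hS : MeasurableSet Q.support := Measure.isClosed_support.measurableSet
  have ext0 : ∀ {ρ : Measure ℝ} {c : ℝ≥0∞}, (∀ s, MeasurableSet s → ρ s ≤ c * Q s) →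
      Measurable (Q.support.domRestrict (dens ρ Q)) → Measurable (dens ρ Q) := by
    intro ρ c hρ hm
    refine measurable_of_restrict_of_restrict_compl hS hm ?_
    have : Q.supportᶜ.domRestrict (dens ρ Q) = fun _ => 0 := by
      funext y
      exact dens_eq_zero_of_notMem_support hρ y.2
    rw [this]
    exact measurable_const
  -- On the support `dens Q Q = 1`, so the pointwise inequality for `L` and `Q` says that `dens L Q`
  -- decreases there; symmetrically `dens U Q` increases.
  have mL : Measurable (dens L Q) := by
    refine ext0 hL' (measurable_of_antitoneOn fun a ha b hb hab => ?_)
    rcases hab.eq_or_lt with rfl | hab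
    · exact le_rfl
    · simpa [dens_self ha, dens_self hb] using dens_mul_le tL tQ hLQ hab
  have mU : Measurable (dens U Q) := by
    refine ext0 hU' (measurable_of_monotoneOn fun a ha b hb hab => ?_)
    rcases hab.eq_or_lt with rfl | hab
    · exact le_rfl
    · simpa [dens_self ha, dens_self hb] using dens_mul_le tQ tU hQU hab
  set T₁ := {y | dens L Q y ≠ 0}
  have hT₁ : MeasurableSet T₁ := (mL (measurableSet_singleton 0)).compl
  set T₂ := {y | dens U Q y ≠ 0}
  have hT₂ : MeasurableSet T₂ := (mU (measurableSet_singleton 0)).compl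
  -- Write `dens μ Q` as a monotone ratio times a density already known to be measurable.
  have m₁ : Measurable (T₁.domRestrict (dens μ Q)) :=
    measurable_of_restrict_div mL tL (fun y hy => hy) <| measurable_of_monotoneOn <|
      monotoneOn_div tL (fun y hy => hy) fun y₁ y₂ h => dens_mul_le tL tμ hLμ h
  have m₂ : Measurable (T₂.domRestrict (dens μ Q)) :=
    measurable_of_restrict_div mU tU (fun y hy => hy) <| measurable_of_antitoneOn <|
      antitoneOn_div tU (fun y hy => hy) fun y₁ y₂ h => dens_mul_le tμ tU hμU h
  have hcov : ∀ y, y ∉ T₁ → y ∉ T₂ → dens μ Q y = 0 := by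
    intro y h₁ h₂
    by_cases hy : y ∈ Q.support
    · have := one_le_dens_add_dens hLU hy
      simp only [T₁, T₂, mem_ofPred_eq, not_not] at h₁ h₂
      simp [h₁, h₂] at this
    · exact dens_eq_zero_of_notMem_support hμ hy
  intro V hV
  have e : dens μ Q ⁻¹' V = (T₁ ∩ dens μ Q ⁻¹' V) ∪ (T₂ ∩ dens μ Q ⁻¹' V) ∪
      ((T₁ ∪ T₂)ᶜ ∩ {_y | (0 : ℝ≥0∞) ∈ V}) := by
    ext y
    by_cases h₁ : y ∈ T₁ <;> by_cases h₂ : y ∈ T₂ <;> simp [h₁, h₂, hcov y]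
  rw [e]
  have k : ∀ {T : Set ℝ}, MeasurableSet T → Measurable (T.domRestrict (dens μ Q)) →
      MeasurableSet (T ∩ dens μ Q ⁻¹' V) := by
    intro T hT hm
    have := hT.subtype_image (hm hV)
    rwa [Set.domRestrict_eq, Set.preimage_comp, Subtype.image_preimage_coe] at this
  exact ((k hT₁ m₁).union (k hT₂ m₂)).union ((hT₁.union hT₂).compl.inter (MeasurableSet.const _))

end Dens

/-! ### Conditional laws as pointwise limits -/

/-- The limit of `R(I × B) / R(I × ℝ)` as the interval `I` shrinks to `z`. -/
noncomputable def condLim (R : Measure (ℝ × ℝ)) (z : ℝ) (B : Set ℝ) : ℝ≥0∞ :=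
  ulim fun r => R (closedBall z r ×ˢ B) / R.fst (closedBall z r)

theorem prod_le_fst (R : Measure (ℝ × ℝ)) {A : Set ℝ} (hA : MeasurableSet A) (B : Set ℝ) :
    R (A ×ˢ B) ≤ R.fst A := by
  rw [Measure.fst_apply hA]
  exact measure_mono fun p hp => hp.1

theorem prod_le_snd (R : Measure (ℝ × ℝ)) (A : Set ℝ) {B : Set ℝ} (hB : MeasurableSet B) :
    R (A ×ˢ B) ≤ R.snd B := by
  rw [Measure.snd_apply hB]
  exact measure_mono fun p hp => hp.2

theorem condLim_le_one (R : Measure (ℝ × ℝ)) (z : ℝ) (B : Set ℝ) : condLim R z B ≤ 1 :=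
  ulim_le fun _ => ENNReal.div_le_of_le_mul <| by
    rw [one_mul]
    exact prod_le_fst R measurableSet_closedBall B

theorem condLim_ne_top (R : Measure (ℝ × ℝ)) (z : ℝ) (B : Set ℝ) : condLim R z B ≠ ∞ :=
  ((condLim_le_one R z B).trans_lt ENNReal.one_lt_top).ne

theorem condLim_union (R : Measure (ℝ × ℝ)) (z : ℝ) {A B : Set ℝ} (hB : MeasurableSet B)
    (h : Disjoint A B) : condLim R z (A ∪ B) = condLim R z A + condLim R z B := by
  refine ulim_eq (((tendsto_ulim _).add (tendsto_ulim _)).congr fun r => ?_)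
  rw [Set.prod_union, measure_union (Set.disjoint_prod.2 (.inr h))
    (measurableSet_closedBall.prod hB), ENNReal.add_div]

theorem condLim_univ (R : Measure (ℝ × ℝ)) [IsFiniteMeasure R] {z : ℝ}
    (hz : z ∈ R.fst.support) : condLim R z univ = 1 := by
  refine ulim_eq (tendsto_const_nhds.congr' ?_)
  filter_upwards [eventually_measure_closedBall_pos hz] with r hr
  have : R (closedBall z r ×ˢ univ) = R.fst (closedBall z r) := by
    rw [Measure.fst_apply measurableSet_closedBall, Set.prod_univ]
  rw [this, ENNReal.div_self hr.ne' (measure_ne_top _ _)]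

/-! ### TP2 comparison and domination of the pointwise conditional laws -/

section LR

variable {R : Measure (ℝ × ℝ)}

theorem IsTP2Measure.condLim_setLR (hR : IsTP2Measure R) {z₁ z₂ : ℝ} (hz : z₁ < z₂) :
    SetLR (condLim R z₁) (condLim R z₂) := by
  intro B₁ B₂ h₁ h₂ hB
  refine mul_le_mul_of_tendsto (tendsto_ulim _) (tendsto_ulim _) (tendsto_ulim _) (tendsto_ulim _)
    (condLim_ne_top _ _ _) (condLim_ne_top _ _ _) (condLim_ne_top _ _ _) (condLim_ne_top _ _ _) ?_
  filter_upwards [eventually_setLT_closedBall hz] with r hr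
  have : SetLR (fun B => R (closedBall z₁ r ×ˢ B)) (fun B => R (closedBall z₂ r ×ˢ B)) :=
    fun B₁ B₂ h₁ h₂ hB => hR _ _ _ _ measurableSet_closedBall measurableSet_closedBall h₁ h₂ hr hB
  exact this.div _ _ B₁ B₂ h₁ h₂ hB

variable [IsFiniteMeasure R]

theorem tendsto_Iic_prod (z : ℝ) {B : Set ℝ} (hB : MeasurableSet B) :
    Tendsto (fun r => R (Iic (z + r) ×ˢ B)) rightUltrafilter (𝓝 (R (Iic z ×ˢ B))) := by
  refine Tendsto.mono_left ?_ rightUltrafilter_le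
  have := tendsto_measure_biInter_gt (μ := R) (s := fun r : ℝ => Iic (z + r) ×ˢ B) (a := 0)
    (fun r _ => (measurableSet_Iic.prod hB).nullMeasurableSet)
    (fun i j _ hij => Set.prod_mono (Iic_subset_Iic.2 (by linarith)) le_rfl)
    ⟨1, one_pos, measure_ne_top _ _⟩
  convert! this using 3
  ext p
  simp only [mem_prod, mem_Iic, gt_iff_lt, mem_iInter]
  exact ⟨fun h r hr => ⟨by linarith [h.1], h.2⟩,
    fun h => ⟨le_of_forall_pos_le_add fun r hr => (h r hr).1, (h 1 one_pos).2⟩⟩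

theorem tendsto_Ici_prod (z : ℝ) {B : Set ℝ} (hB : MeasurableSet B) :
    Tendsto (fun r => R (Ici (z - r) ×ˢ B)) rightUltrafilter (𝓝 (R (Ici z ×ˢ B))) := by
  refine Tendsto.mono_left ?_ rightUltrafilter_le
  have := tendsto_measure_biInter_gt (μ := R) (s := fun r : ℝ => Ici (z - r) ×ˢ B) (a := 0)
    (fun r _ => (measurableSet_Ici.prod hB).nullMeasurableSet)
    (fun i j _ hij => Set.prod_mono (Ici_subset_Ici.2 (by linarith)) le_rfl)
    ⟨1, one_pos, measure_ne_top _ _⟩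
  convert! this using 3
  ext p
  simp only [mem_prod, mem_Ici, gt_iff_lt, mem_iInter]
  refine ⟨fun h r hr => ⟨by linarith [h.1], h.2⟩,
    fun h => ⟨le_of_forall_pos_le_add fun r hr => ?_, (h 1 one_pos).2⟩⟩
  linarith [(h r hr).1]

theorem eventually_pos : ∀ᶠ r in (rightUltrafilter : Filter ℝ), 0 < r :=
  rightUltrafilter_le self_mem_nhdsWithin

/-- `Iic (z + r)` and `closedBall z r` overlap in the ball, so the union lemma with empty `D`
applies; then let `r` tend to `0`. -/
theorem IsTP2Measure.setLR_Iic_condLim (hR : IsTP2Measure R) (z : ℝ) :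
    SetLR (fun B => R (Iic z ×ˢ B)) (condLim R z) := by
  intro B₁ B₂ h₁ h₂ hB
  refine mul_le_mul_of_tendsto (tendsto_ulim _) (tendsto_Iic_prod z h₂) (tendsto_Iic_prod z h₁)
    (tendsto_ulim _) (condLim_ne_top _ _ _) (measure_ne_top _ _) (measure_ne_top _ _)
    (condLim_ne_top _ _ _) ?_
  filter_upwards [eventually_pos] with r hr
  have := hR.setLR_union (C := Iio (z - r)) (I := closedBall z r) (D := ∅) measurableSet_Iio
    measurableSet_closedBall .empty (fun a ha b hb => by
      rw [Real.closedBall_eq_Icc] at hb; exact lt_of_lt_of_le ha hb.1)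
    (by simp [SetLT]) (by simp [SetLT])
  rw [Real.closedBall_eq_Icc, Iio_union_Icc_eq_Iic (by linarith), union_empty] at this
  simpa [Real.closedBall_eq_Icc] using this.div 1 (R.fst (Icc (z - r) (z + r))) B₁ B₂ h₁ h₂ hB

theorem IsTP2Measure.setLR_condLim_Ici (hR : IsTP2Measure R) (z : ℝ) :
    SetLR (condLim R z) (fun B => R (Ici z ×ˢ B)) := by
  intro B₁ B₂ h₁ h₂ hB
  refine mul_le_mul_of_tendsto (tendsto_Ici_prod z h₁) (tendsto_ulim _) (tendsto_ulim _)
    (tendsto_Ici_prod z h₂) (measure_ne_top _ _) (condLim_ne_top _ _ _) (condLim_ne_top _ _ _)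
    (measure_ne_top _ _) ?_
  filter_upwards [eventually_pos] with r hr
  have := hR.setLR_union (C := ∅) (I := closedBall z r) (D := Ioi (z + r)) .empty
    measurableSet_closedBall measurableSet_Ioi (by simp [SetLT]) (fun a ha b hb => by
      rw [Real.closedBall_eq_Icc] at ha; exact lt_of_le_of_lt ha.2 hb) (by simp [SetLT])
  rw [Real.closedBall_eq_Icc, Icc_union_Ioi_eq_Ici (by linarith), empty_union] at this
  simpa [Real.closedBall_eq_Icc] using this.div (R.fst (Icc (z - r) (z + r))) 1 B₁ B₂ h₁ h₂ hB

/-- Split `B` at `y₀`. The lower part is compared with `Ioi y₀` under `Iic z`, the upper part with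
`Iio y₀` under `Ici z`; the positive quadrant masses are divided out. -/
theorem IsTP2Measure.condLim_le (hR : IsTP2Measure R) (z y₀ : ℝ)
    (hL : R (Iic z ×ˢ Ioi y₀) ≠ 0) (hU : R (Ici z ×ˢ Iio y₀) ≠ 0) {B : Set ℝ}
    (hB : MeasurableSet B) :
    condLim R z B ≤ ((R (Iic z ×ˢ Ioi y₀))⁻¹ + (R (Ici z ×ˢ Iio y₀))⁻¹) * R.snd B := by
  have e : B = (B ∩ Iic y₀) ∪ (B ∩ Ioi y₀) := by
    rw [← inter_union_distrib_left, Iic_union_Ioi, inter_univ]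
  have h₁ : condLim R z (B ∩ Iic y₀) ≤ (R (Iic z ×ˢ Ioi y₀))⁻¹ * R.snd B := by
    rw [mul_comm, ← div_eq_mul_inv,
      ENNReal.le_div_iff_mul_le (.inl hL) (.inl (measure_ne_top _ _))]
    calc _ ≤ R (Iic z ×ˢ (B ∩ Iic y₀)) * condLim R z (Ioi y₀) :=
          hR.setLR_Iic_condLim z _ _ (hB.inter measurableSet_Iic) measurableSet_Ioi
            fun a ha b hb => lt_of_le_of_lt ha.2 hb
      _ ≤ R.snd (B ∩ Iic y₀) * 1 := by
          gcongr
          · exact prod_le_snd R _ (hB.inter measurableSet_Iic)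
          · exact condLim_le_one _ _ _
      _ ≤ R.snd B := by
          rw [mul_one]
          exact measure_mono inter_subset_left
  have h₂ : condLim R z (B ∩ Ioi y₀) ≤ (R (Ici z ×ˢ Iio y₀))⁻¹ * R.snd B := by
    rw [mul_comm, ← div_eq_mul_inv,
      ENNReal.le_div_iff_mul_le (.inl hU) (.inl (measure_ne_top _ _)), mul_comm]
    calc _ ≤ condLim R z (Iio y₀) * R (Ici z ×ˢ (B ∩ Ioi y₀)) :=
          hR.setLR_condLim_Ici z _ _ measurableSet_Iio (hB.inter measurableSet_Ioi)
            fun a ha b hb => lt_trans ha hb.2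
      _ ≤ 1 * R.snd (B ∩ Ioi y₀) := by
          gcongr
          · exact condLim_le_one _ _ _
          · exact prod_le_snd R _ (hB.inter measurableSet_Ioi)
      _ ≤ R.snd B := by
          rw [one_mul]
          exact measure_mono inter_subset_left
  calc condLim R z B = condLim R z (B ∩ Iic y₀) + condLim R z (B ∩ Ioi y₀) := by
        conv_lhs => rw [e]
        refine condLim_union R z (hB.inter measurableSet_Ioi) ?_
        exact Set.disjoint_left.2 fun a ha hb => not_lt.2 (mem_Iic.1 ha.2) (mem_Ioi.1 hb.2)
    _ ≤ _ := by
        rw [add_mul]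
        exact add_le_add h₁ h₂

end LR

/-- Domination by a finite measure makes the tails of a disjoint union vanish, which upgrades finite
to countable additivity. -/
theorem exists_measure_of_additive {m : Set ℝ → ℝ≥0∞} {Q : Measure ℝ} [IsFiniteMeasure Q]
    {C : ℝ≥0∞} (hC : C ≠ ∞) (hle : ∀ B, MeasurableSet B → m B ≤ C * Q B)
    (hadd : ∀ A B, MeasurableSet A → MeasurableSet B → Disjoint A B → m (A ∪ B) = m A + m B) :
    ∃ μ : Measure ℝ, ∀ B, MeasurableSet B → μ B = m B := by
  have h0 : m ∅ = 0 := by simpa using hle ∅ .empty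
  refine ⟨Measure.ofMeasurable (fun s _ => m s) h0 ?_, fun B hB => Measure.ofMeasurable_apply B hB⟩
  intro f hf hd
  have hmeas : ∀ n : ℕ, MeasurableSet (⋃ i ≥ n, f i) := fun n =>
    .iUnion fun i => .iUnion fun _ => hf i
  have hstep : ∀ n, m (⋃ i ≥ n, f i) = m (f n) + m (⋃ i ≥ n + 1, f i) := by
    intro n
    rw [← hadd _ _ (hf n) (hmeas _)]
    · congr 1
      ext y
      simp only [ge_iff_le, mem_iUnion, exists_prop, mem_union]
      constructor
      · rintro ⟨i, hi, hy⟩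
        rcases hi.eq_or_lt with rfl | hi
        · exact .inl hy
        · exact .inr ⟨i, hi, hy⟩
      · rintro (hy | ⟨i, hi, hy⟩)
        · exact ⟨n, le_rfl, hy⟩
        · exact ⟨i, by omega, hy⟩
    · simp only [Set.disjoint_iUnion_right]
      exact fun i hi => hd (by omega)
  have hsum : ∀ n, m (⋃ i, f i) = ∑ i ∈ Finset.range n, m (f i) + m (⋃ i ≥ n, f i) := by
    intro n
    induction n with
    | zero => simp
    | succ n ih => rw [ih, hstep n, Finset.sum_range_succ, add_assoc]
  have htail : Tendsto (fun n : ℕ => m (⋃ i ≥ n, f i)) atTop (𝓝 0) := by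
    have h1 := tendsto_measure_biUnion_Ici_zero_of_pairwise_disjoint (μ := Q)
      (fun i => (hf i).nullMeasurableSet) hd
    have h2 : Tendsto (fun n : ℕ => C * Q (⋃ i ≥ n, f i)) atTop (𝓝 (C * 0)) :=
      ENNReal.Tendsto.const_mul h1 (.inr hC)
    rw [mul_zero] at h2
    exact tendsto_of_tendsto_of_tendsto_of_le_of_le tendsto_const_nhds h2 (fun _ => zero_le)
      fun n => hle _ (hmeas n)
  have hlim := (ENNReal.tendsto_nat_tsum fun i => m (f i)).add htail
  rw [add_zero] at hlim
  exact tendsto_nhds_unique (tendsto_const_nhds.congr hsum) hlim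

/-! ### The boundary functions -/

section Boundary

variable {R : Measure (ℝ × ℝ)}

theorem setOf_Iic_eq (x y : ℝ) :
    {p : ℝ × ℝ | p.1 ≤ x ∧ (y : EReal) < (p.2 : EReal)} = Iic x ×ˢ Ioi y := by
  ext p
  simp

theorem setOf_Ici_eq (x y : ℝ) :
    {p : ℝ × ℝ | x ≤ p.1 ∧ (p.2 : EReal) < (y : EReal)} = Ici x ×ˢ Iio y := by
  ext p
  simp

theorem lt_nw_iff {x y : ℝ} : (y : EReal) < nw R x ↔ R (Iic x ×ˢ Ioi y) ≠ 0 := by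
  rw [← setOf_Iic_eq]
  refine ⟨fun h h0 => not_le.2 h ((isLeast_nw R x).2 h0), fun h => not_le.1 fun hle => h ?_⟩
  exact measure_mono_null (fun p hp => by exact ⟨hp.1, hle.trans_lt hp.2⟩) (isLeast_nw R x).1

theorem se_lt_iff {x y : ℝ} : se R x < (y : EReal) ↔ R (Ici x ×ˢ Iio y) ≠ 0 := by
  rw [← setOf_Ici_eq]
  refine ⟨fun h h0 => not_le.2 h ((isGreatest_se R x).2 h0), fun h => not_le.1 fun hle => h ?_⟩
  exact measure_mono_null (fun p hp => by exact ⟨hp.1, hp.2.trans_le hle⟩) (isGreatest_se R x).1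

theorem nw_mono : Monotone (nw R) := fun _ x₂ h =>
  (isLeast_nw R _).2 <| measure_mono_null (fun _ hp => by exact ⟨hp.1.trans h, hp.2⟩) (isLeast_nw R x₂).1

theorem se_mono : Monotone (se R) := fun x₁ _ h =>
  (isGreatest_se R _).2 <|
    measure_mono_null (fun _ hp => by exact ⟨h.trans hp.1, hp.2⟩) (isGreatest_se R x₁).1

theorem nw_ne_bot {x : ℝ} (hx : x ∈ xRange R) : nw R x ≠ ⊥ := by
  intro h
  have := (isLeast_nw R x).1
  rw [h] at this
  simp only [EReal.bot_lt_coe, and_true, mem_ofPred_eq] at this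
  exact hx.1.ne' this

theorem se_ne_top {x : ℝ} (hx : x ∈ xRange R) : se R x ≠ ⊤ := by
  intro h
  have := (isGreatest_se R x).1
  rw [h] at this
  simp only [EReal.coe_lt_top, and_true, mem_ofPred_eq] at this
  exact hx.2.ne' this

/-- On `xo R`, `⊥ < nw ≤ se < ⊤`, so `nw` itself is a real isotonic choice. -/
theorem exists_isIsotonicSelection : ∃ S : xo R → ℝ, IsIsotonicSelection R S := by
  have hc : ∀ x : xo R, ((nw R x).toReal : EReal) = nw R x := fun x =>
    EReal.coe_toReal (ne_top_of_le_ne_top (se_ne_top x.2.1) x.2.2) (nw_ne_bot x.2.1)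
  refine ⟨fun x => (nw R x).toReal, fun a b hab => ?_, fun x => ?_⟩
  · rw [← EReal.coe_le_coe_iff, hc, hc]
    exact nw_mono hab
  · rw [hc]
    exact ⟨le_rfl, x.2.2⟩

/-- `D` may be uncountable, so nullity is checked locally: a point of `D` below another one has a
null neighbourhood, and a maximal point has all of `D` in its half-line. -/
theorem measure_prod_eq_zero_of_Iic {D B : Set ℝ}
    (h : ∀ x ∈ D, R (Iic x ×ˢ B) = 0) : R (D ×ˢ B) = 0 := by
  refine measure_null_of_locally_null _ fun p hp => ?_
  by_cases hmax : ∃ x ∈ D, p.1 < x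
  · obtain ⟨x, hx, hpx⟩ := hmax
    refine ⟨Iic x ×ˢ B, ?_, h x hx⟩
    have h1 : Iio x ×ˢ univ ∈ 𝓝 p := prod_mem_nhds (Iio_mem_nhds hpx) univ_mem
    filter_upwards [mem_nhdsWithin_of_mem_nhds h1, self_mem_nhdsWithin] with q hq hq'
    exact ⟨(mem_Iio.1 hq.1).le, hq'.2⟩
  · push Not at hmax
    refine ⟨Iic p.1 ×ˢ B, ?_, h _ hp.1⟩
    filter_upwards [self_mem_nhdsWithin] with q hq
    exact ⟨hmax _ hq.1, hq.2⟩

theorem measure_prod_eq_zero_of_Ici {D B : Set ℝ}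
    (h : ∀ x ∈ D, R (Ici x ×ˢ B) = 0) : R (D ×ˢ B) = 0 := by
  refine measure_null_of_locally_null _ fun p hp => ?_
  by_cases hmin : ∃ x ∈ D, x < p.1
  · obtain ⟨x, hx, hpx⟩ := hmin
    refine ⟨Ici x ×ˢ B, ?_, h x hx⟩
    have h1 : Ioi x ×ˢ univ ∈ 𝓝 p := prod_mem_nhds (Ioi_mem_nhds hpx) univ_mem
    filter_upwards [mem_nhdsWithin_of_mem_nhds h1, self_mem_nhdsWithin] with q hq hq'
    exact ⟨(mem_Ioi.1 hq.1).le, hq'.2⟩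
  · push Not at hmin
    refine ⟨Ici p.1 ×ˢ B, ?_, h _ hp.1⟩
    filter_upwards [self_mem_nhdsWithin] with q hq
    exact ⟨hmin _ hq.1, hq.2⟩

/-- A rational strictly between the boundary and the second coordinate reduces the bad set to
countably many null rectangles. -/
theorem ae_le_nw : ∀ᵐ p ∂ R, (p.2 : EReal) ≤ nw R p.1 := by
  rw [ae_iff]
  refine measure_mono_null (t := ⋃ q : ℚ, {x | nw R x < ((q : ℝ) : EReal)} ×ˢ Ioi (q : ℝ))
    ?_ (measure_iUnion_null fun q => ?_)
  · intro p hp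
    obtain ⟨q, h₁, h₂⟩ := EReal.lt_iff_exists_rat_btwn.1 (not_le.1 hp)
    exact mem_iUnion.2 ⟨q, h₁, EReal.coe_lt_coe_iff.1 h₂⟩
  · refine measure_prod_eq_zero_of_Iic ?_
    intro x hx
    by_contra h0
    exact not_lt.2 (le_of_lt hx) (lt_nw_iff.2 h0)

theorem ae_se_le : ∀ᵐ p ∂ R, se R p.1 ≤ (p.2 : EReal) := by
  rw [ae_iff]
  refine measure_mono_null (t := ⋃ q : ℚ, {x | ((q : ℝ) : EReal) < se R x} ×ˢ Iio (q : ℝ))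
    ?_ (measure_iUnion_null fun q => ?_)
  · intro p hp
    obtain ⟨q, h₁, h₂⟩ := EReal.lt_iff_exists_rat_btwn.1 (not_le.1 hp)
    exact mem_iUnion.2 ⟨q, h₂, EReal.coe_lt_coe_iff.1 h₁⟩
  · refine measure_prod_eq_zero_of_Ici ?_
    intro x hx
    by_contra h0
    exact not_lt.2 (le_of_lt hx) (se_lt_iff.2 h0)

theorem setOf_fst_le_eq (x : ℝ) : {p : ℝ × ℝ | p.1 ≤ x} = Iic x ×ˢ univ := by
  ext p
  simp

theorem setOf_le_fst_eq (x : ℝ) : {p : ℝ × ℝ | x ≤ p.1} = Ici x ×ˢ univ := by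
  ext p
  simp

theorem ae_fst_mem_xRange : ∀ᵐ p ∂ R, p.1 ∈ xRange R := by
  have h₁ : R ({x | R {p | p.1 ≤ x} = 0} ×ˢ univ) = 0 :=
    measure_prod_eq_zero_of_Iic fun x hx => by rwa [← setOf_fst_le_eq]
  have h₂ : R ({x | R {p | x ≤ p.1} = 0} ×ˢ univ) = 0 :=
    measure_prod_eq_zero_of_Ici fun x hx => by rwa [← setOf_le_fst_eq]
  rw [ae_iff]
  refine measure_mono_null (fun p hp => ?_) (measure_union_null h₁ h₂)
  by_contra hcon
  simp only [mem_union, mem_prod, mem_ofPred_eq, mem_univ, and_true, not_or] at hcon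
  exact hp ⟨pos_iff_ne_zero.2 hcon.1, pos_iff_ne_zero.2 hcon.2⟩

theorem ordConnected_xRange : OrdConnected (xRange R) :=
  ⟨fun _ ha _ hb _ hx => ⟨ha.1.trans_le (measure_mono fun _ hp => le_trans hp hx.1),
    hb.2.trans_le (measure_mono fun _ hp => le_trans hx.2 hp)⟩⟩

end Boundary

/-! ### Almost everywhere identification with the conditional law -/

/-- Differentiate `A ↦ R (A ×ˢ B)` with respect to the first marginal; the exceptional null set
depends on `B`. -/
theorem ae_condLim_eq_condKernel (R : Measure (ℝ × ℝ)) [IsFiniteMeasure R] {B : Set ℝ}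
    (hB : MeasurableSet B) : ∀ᵐ x ∂ R.fst, condLim R x B = R.condKernel x B := by
  set ρ : Measure ℝ := R.fst.withDensity fun x => R.condKernel x B
  have hm : Measurable fun x => R.condKernel x B := Kernel.measurable_coe _ hB
  have hρ : ∀ A, MeasurableSet A → ρ A = R (A ×ˢ B) := by
    intro A hA
    conv_rhs => rw [← R.disintegrate R.condKernel]
    rw [withDensity_apply _ hA, Measure.compProd_apply_prod hA hB]
  have : IsFiniteMeasure ρ := ⟨by rw [hρ _ .univ]; exact measure_lt_top _ _⟩
  filter_upwards [Besicovitch.ae_tendsto_rnDeriv ρ R.fst,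
    Measure.rnDeriv_withDensity R.fst hm] with x hx hx'
  rw [hx'] at hx
  refine ulim_eq_of_tendsto (hx.congr fun r => ?_)
  rw [hρ _ measurableSet_closedBall]

/-! ### Criteria for the likelihood ratio order -/

theorem lrLe_withDensity {μ : Measure ℝ} [SigmaFinite μ] {f₁ f₂ : ℝ → ℝ≥0∞}
    (m₁ : Measurable f₁) (m₂ : Measurable f₂) (n₁ : ∀ y, f₁ y ≠ ∞) (n₂ : ∀ y, f₂ y ≠ ∞)
    (h : ∀ y₁ y₂, y₁ < y₂ → f₂ y₁ * f₁ y₂ ≤ f₁ y₁ * f₂ y₂) :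
    LRLe (μ.withDensity f₁) (μ.withDensity f₂) := by
  refine ⟨μ, fun y => (f₁ y).toNNReal, fun y => (f₂ y).toNNReal, inferInstance,
    m₁.ennreal_toNNReal, m₂.ennreal_toNNReal, ?_, ?_, ?_⟩
  · simp only [ENNReal.coe_toNNReal (n₁ _)]
  · simp only [ENNReal.coe_toNNReal (n₂ _)]
  · simp only [ENNReal.coe_toNNReal (n₁ _), ENNReal.coe_toNNReal (n₂ _)]
    -- At most one density vanishes on the relevant set, so `0 / 0` never enters the ratio.
    have pos : ∀ {y}, y ∈ {y | 0 < (f₁ y).toNNReal + (f₂ y).toNNReal} → f₁ y = 0 → f₂ y ≠ 0 := by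
      intro y hy h₁ h₂
      simp [h₁, h₂] at hy
    intro a ha b hb hab
    rcases hab.eq_or_lt with rfl | hab
    · exact le_rfl
    · have hab := h a b hab
      by_cases hb0 : f₁ b = 0
      · simp only [hb0, ENNReal.div_zero (pos hb hb0), le_top]
      · have ha0 : f₁ a ≠ 0 := by
          intro ha0
          rw [ha0, zero_mul, nonpos_iff_eq_zero, mul_eq_zero] at hab
          exact hab.elim (pos ha ha0) hb0
        show f₂ a / f₁ a ≤ f₂ b / f₁ b
        rw [ENNReal.div_le_iff ha0 (n₁ a), div_eq_mul_inv, mul_right_comm, ← div_eq_mul_inv,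
          ENNReal.le_div_iff_mul_le (.inl hb0) (.inl (n₁ b)), mul_comm (f₂ b)]
        exact hab

/-- A common dominating measure for a point mass and `ν`, with explicit densities; `ν` may or may
not have an atom at `s`. -/
theorem withDensity_dirac_add_restrict {ν : Measure ℝ} {s : ℝ} {T : Set ℝ}
    (hT : MeasurableSet T) (hs : s ∉ T) (hν : ν ({s} ∪ T)ᶜ = 0) :
    (Measure.dirac s + ν.restrict T).withDensity (indicator {s} 1) = Measure.dirac s ∧
    (Measure.dirac s + ν.restrict T).withDensity
      (indicator {s} (fun _ => ν {s}) + indicator T 1) = ν := by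
  have hd : Disjoint {s} T := Set.disjoint_singleton_left.2 hs
  have e₁ : (Measure.dirac s + ν.restrict T).restrict {s} = Measure.dirac s := by
    rw [Measure.restrict_add, Measure.restrict_restrict (measurableSet_singleton s),
      hd.inter_eq, Measure.restrict_empty, add_zero, Measure.restrict_singleton]
    simp
  have e₂ : (Measure.dirac s + ν.restrict T).restrict T = ν.restrict T := by
    rw [Measure.restrict_add, Measure.restrict_restrict hT, inter_self,
      Measure.restrict_eq_zero.2, zero_add]
    simp [Measure.dirac_apply' _ hT, hs]
  refine ⟨?_, ?_⟩
  · rw [withDensity_indicator_one (measurableSet_singleton s), e₁]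
  · rw [withDensity_add_left (measurable_const.indicator (measurableSet_singleton s)),
      withDensity_indicator (measurableSet_singleton s), withDensity_indicator_one hT, e₁, e₂,
      withDensity_const, ← Measure.restrict_singleton, ← Measure.restrict_union hd hT]
    exact Measure.restrict_eq_self_of_ae_mem hν

theorem lrLe_dirac_left {ν : Measure ℝ} [IsFiniteMeasure ν] {s : ℝ} (hν : ν (Iio s) = 0) :
    LRLe (Measure.dirac s) ν := by
  obtain ⟨e₁, e₂⟩ := withDensity_dirac_add_restrict (ν := ν) (s := s) measurableSet_Ioi
    (lt_irrefl s) (by rwa [singleton_union, Ioi_insert, compl_Ici])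
  have := lrLe_withDensity (μ := Measure.dirac s + ν.restrict (Ioi s))
    (f₁ := indicator {s} 1) (f₂ := indicator {s} (fun _ => ν {s}) + indicator (Ioi s) 1)
    (measurable_one.indicator (measurableSet_singleton s))
    ((measurable_const.indicator (measurableSet_singleton s)).add
      (measurable_one.indicator measurableSet_Ioi)) ?_ ?_ ?_
  · rwa [e₁, e₂] at this
  · intro y
    by_cases h : y = s <;> simp [h]
  · intro y
    by_cases h : y = s <;> by_cases h' : s < y <;> simp [h, h', measure_ne_top]
  · intro a b hab
    by_cases hb : b = s
    · subst hb
      simp [hab.ne, not_lt.2 hab.le]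
    · simp [hb]

theorem lrLe_dirac_right {ν : Measure ℝ} [IsFiniteMeasure ν] {s : ℝ} (hν : ν (Ioi s) = 0) :
    LRLe ν (Measure.dirac s) := by
  obtain ⟨e₁, e₂⟩ := withDensity_dirac_add_restrict (ν := ν) (s := s) measurableSet_Iio
    (lt_irrefl s) (by rwa [singleton_union, Iio_insert, compl_Iic])
  have := lrLe_withDensity (μ := Measure.dirac s + ν.restrict (Iio s))
    (f₂ := indicator {s} 1) (f₁ := indicator {s} (fun _ => ν {s}) + indicator (Iio s) 1)
    ((measurable_const.indicator (measurableSet_singleton s)).add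
      (measurable_one.indicator measurableSet_Iio))
    (measurable_one.indicator (measurableSet_singleton s)) ?_ ?_ ?_
  · rwa [e₁, e₂] at this
  · intro y
    by_cases h : y = s <;> by_cases h' : y < s <;> simp [h, h', measure_ne_top]
  · intro y
    by_cases h : y = s <;> simp [h]
  · intro a b hab
    by_cases ha : a = s
    · subst ha
      simp [hab.ne', not_lt.2 hab.le]
    · simp [ha]

theorem LRLe.setLR {Q₁ Q₂ : Measure ℝ} (h : LRLe Q₁ Q₂) :
    SetLR (fun s => Q₁ s) (fun s => Q₂ s) := by
  obtain ⟨μ, g₁, g₂, _, m₁, m₂, rfl, rfl, hmono⟩ := h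
  have tp : ∀ a b, a < b → (g₂ a : ℝ≥0∞) * g₁ b ≤ g₁ a * g₂ b := by
    intro a b hab
    by_cases hb : g₁ b = 0
    · simp [hb]
    by_cases ha : g₂ a = 0
    · simp [ha]
    have key := hmono (a := a) (b := b) (by simp [pos_iff_ne_zero, ha])
      (by simp [pos_iff_ne_zero, hb]) hab.le
    have ha1 : g₁ a ≠ 0 := by
      intro h0
      simp only [h0, ENNReal.coe_zero, ENNReal.div_zero (ENNReal.coe_ne_zero.2 ha),
        top_le_iff] at key
      exact ENNReal.div_ne_top ENNReal.coe_ne_top (ENNReal.coe_ne_zero.2 hb) key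
    simp only at key
    rwa [ENNReal.div_le_iff (ENNReal.coe_ne_zero.2 ha1) ENNReal.coe_ne_top, div_eq_mul_inv,
      mul_right_comm, ← div_eq_mul_inv,
      ENNReal.le_div_iff_mul_le (.inl (ENNReal.coe_ne_zero.2 hb)) (.inl ENNReal.coe_ne_top),
      mul_comm (g₂ b : ℝ≥0∞)] at key
  intro B₁ B₂ h₁ h₂ hB
  simp only [withDensity_apply _ h₁, withDensity_apply _ h₂]
  rw [← lintegral_mul_const _ m₂.coe_nnreal_ennreal, ← lintegral_mul_const _ m₁.coe_nnreal_ennreal]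
  refine setLIntegral_mono' h₁ fun a ha => ?_
  rw [← lintegral_const_mul _ m₁.coe_nnreal_ennreal, ← lintegral_const_mul _ m₂.coe_nnreal_ennreal]
  exact setLIntegral_mono' h₂ fun b hb => tp a b (hB a ha b hb)

/-- Likelihood ratio order implies stochastic order: add `Q₂ (Iic y) * Q₁ (Iic y)` to both sides of
the cross inequality. -/
theorem LRLe.measure_Iic_le {Q₁ Q₂ : Measure ℝ} [IsProbabilityMeasure Q₁]
    [IsProbabilityMeasure Q₂] (h : LRLe Q₁ Q₂) (y : ℝ) : Q₂ (Iic y) ≤ Q₁ (Iic y) := by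
  have key := h.setLR (Iic y) (Ioi y) measurableSet_Iic measurableSet_Ioi
    fun a ha b hb => lt_of_le_of_lt ha hb
  have hu : ∀ (ν : Measure ℝ) [IsProbabilityMeasure ν], ν (Iic y) + ν (Ioi y) = 1 := fun ν _ => by
    rw [← measure_union (Set.disjoint_left.2 fun a ha hb => not_lt.2 (mem_Iic.1 ha) (mem_Ioi.1 hb))
      measurableSet_Ioi, Iic_union_Ioi, measure_univ]
  calc Q₂ (Iic y) = Q₂ (Iic y) * Q₁ (Iic y) + Q₂ (Iic y) * Q₁ (Ioi y) := by
        rw [← mul_add, hu, mul_one]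
    _ ≤ Q₂ (Iic y) * Q₁ (Iic y) + Q₁ (Iic y) * Q₂ (Ioi y) := by gcongr
    _ = Q₁ (Iic y) * (Q₂ (Iic y) + Q₂ (Ioi y)) := by ring
    _ = Q₁ (Iic y) := by rw [hu, mul_one]

/-! ### The next point of the support -/

section Slice

variable {R : Measure (ℝ × ℝ)}

/-- The smallest point of the support of the first marginal which is at least `x`. -/
noncomputable def nextPoint (R : Measure (ℝ × ℝ)) (x : ℝ) : ℝ := sInf (R.fst.support ∩ Ici x)

theorem bddBelow_support_inter_Ici (x : ℝ) : BddBelow (R.fst.support ∩ Ici x) :=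
  ⟨x, fun _ hy => hy.2⟩

theorem support_inter_Ici_nonempty {x : ℝ} (hx : x ∈ xRange R) :
    (R.fst.support ∩ Ici x).Nonempty := by
  rw [inter_comm]
  refine Measure.nonempty_inter_support_of_pos ?_
  rw [Measure.fst_apply measurableSet_Ici]
  exact hx.2

theorem nextPoint_mem {x : ℝ} (hx : x ∈ xRange R) : nextPoint R x ∈ R.fst.support ∩ Ici x :=
  (Measure.isClosed_support.inter isClosed_Ici).csInf_mem (support_inter_Ici_nonempty hx)
    (bddBelow_support_inter_Ici x)

theorem nextPoint_mono {x₁ x₂ : ℝ} (h₂ : x₂ ∈ xRange R) (h : x₁ ≤ x₂) :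
    nextPoint R x₁ ≤ nextPoint R x₂ :=
  csInf_le_csInf (bddBelow_support_inter_Ici x₁) (support_inter_Ici_nonempty h₂)
    (inter_subset_inter_right _ (Ici_subset_Ici.2 h))

theorem nextPoint_eq_self {x : ℝ} (hx : x ∈ R.fst.support) : nextPoint R x = x :=
  le_antisymm (csInf_le (bddBelow_support_inter_Ici x) ⟨hx, self_mem_Ici⟩)
    (le_csInf ⟨x, hx, self_mem_Ici⟩ fun _ hy => hy.2)

/-- The gap between `x` and the next support point misses the support, hence carries no mass. -/
theorem measure_Ici_prod_le_nextPoint (R : Measure (ℝ × ℝ)) (x : ℝ) (B : Set ℝ) :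
    R (Ici x ×ˢ B) ≤ R (Ici (nextPoint R x) ×ˢ B) := by
  have h0 : R (Prod.fst ⁻¹' R.fst.supportᶜ) = 0 := by
    rw [← Measure.fst_apply Measure.isClosed_support.measurableSet.compl]
    exact Measure.measure_compl_support
  have hsub : Ici x ×ˢ B ⊆ Ici (nextPoint R x) ×ˢ B ∪ Prod.fst ⁻¹' R.fst.supportᶜ := by
    intro p hp
    by_cases hs : p.1 ∈ R.fst.support
    · exact .inl ⟨csInf_le (bddBelow_support_inter_Ici x) ⟨hs, hp.1⟩, hp.2⟩
    · exact .inr hs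
  calc R (Ici x ×ˢ B) ≤ _ := (measure_mono hsub).trans (measure_union_le _ _)
    _ = _ := by rw [h0, add_zero]

/-! ### The slices -/

theorem exists_between {x : ℝ} (hx : x ∈ xRange R \ xo R) :
    ∃ y : ℝ, se R x < y ∧ (y : EReal) < nw R x :=
  EReal.lt_iff_exists_real_btwn.1 (not_le.1 fun h => hx.2 ⟨hx.1, h⟩)

theorem measure_Iic_nextPoint_ne_zero {x : ℝ} (hx : x ∈ xRange R) {B : Set ℝ}
    (h : R (Iic x ×ˢ B) ≠ 0) : R (Iic (nextPoint R x) ×ˢ B) ≠ 0 := fun h0 =>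
  h (measure_mono_null (prod_mono (Iic_subset_Iic.2 (nextPoint_mem hx).2) le_rfl) h0)

theorem measure_Ici_nextPoint_ne_zero {x : ℝ} {B : Set ℝ}
    (h : R (Ici x ×ˢ B) ≠ 0) : R (Ici (nextPoint R x) ×ˢ B) ≠ 0 := fun h0 =>
  h (nonpos_iff_eq_zero.1 ((measure_Ici_prod_le_nextPoint R x B).trans h0.le))

variable [IsProbabilityMeasure R]

theorem exists_condLim_le (hR : IsTP2Measure R) {x : ℝ} (hx : x ∈ xRange R \ xo R) :
    ∃ C : ℝ≥0∞, C ≠ ∞ ∧ ∀ B, MeasurableSet B → condLim R (nextPoint R x) B ≤ C * R.snd B := by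
  obtain ⟨y, h₁, h₂⟩ := exists_between hx
  have hL := measure_Iic_nextPoint_ne_zero hx.1 (lt_nw_iff.1 h₂)
  have hU := measure_Ici_nextPoint_ne_zero (se_lt_iff.1 h₁)
  exact ⟨_, ENNReal.add_ne_top.2 ⟨ENNReal.inv_ne_top.2 hL, ENNReal.inv_ne_top.2 hU⟩,
    fun B hB => hR.condLim_le _ y hL hU hB⟩

theorem exists_slice (hR : IsTP2Measure R) {x : ℝ} (hx : x ∈ xRange R \ xo R) :
    ∃ μ : Measure ℝ, ∀ B, MeasurableSet B → μ B = condLim R (nextPoint R x) B := by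
  obtain ⟨C, hC, hle⟩ := exists_condLim_le hR hx
  exact exists_measure_of_additive hC hle fun A B _ hB h => condLim_union R _ hB h

open Classical in
/-- The measure that extends the set function `condLim R z` of Borel sets, if there is one. -/
noncomputable def condLimMeasure (R : Measure (ℝ × ℝ)) (z : ℝ) : Measure ℝ :=
  if h : ∃ μ : Measure ℝ, ∀ B, MeasurableSet B → μ B = condLim R z B then h.choose else 0

/-- The conditional law of the second coordinate at `x`, before truncation to the interval between
the boundary functions. -/
noncomputable def slice (R : Measure (ℝ × ℝ)) (x : ℝ) : Measure ℝ :=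
  condLimMeasure R (nextPoint R x)

theorem slice_apply (hR : IsTP2Measure R) {x : ℝ} (hx : x ∈ xRange R \ xo R) {B : Set ℝ}
    (hB : MeasurableSet B) : slice R x B = condLim R (nextPoint R x) B := by
  have h := exists_slice hR hx
  rw [slice, condLimMeasure, dif_pos h]
  exact h.choose_spec B hB

theorem isProbabilityMeasure_slice (hR : IsTP2Measure R) {x : ℝ} (hx : x ∈ xRange R \ xo R) :
    IsProbabilityMeasure (slice R x) :=
  ⟨by rw [slice_apply hR hx .univ, condLim_univ R (nextPoint_mem hx.1).1]⟩

theorem exists_slice_le (hR : IsTP2Measure R) {x : ℝ} (hx : x ∈ xRange R \ xo R) :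
    ∃ C : ℝ≥0∞, C ≠ ∞ ∧ ∀ B, MeasurableSet B → slice R x B ≤ C * R.snd B := by
  obtain ⟨C, hC, hle⟩ := exists_condLim_le hR hx
  exact ⟨C, hC, fun B hB => (slice_apply hR hx hB).trans_le (hle B hB)⟩

theorem dens_slice_ne_top (hR : IsTP2Measure R) {x : ℝ} (hx : x ∈ xRange R \ xo R) (y : ℝ) :
    dens (slice R x) R.snd y ≠ ∞ := by
  obtain ⟨C, hC, hle⟩ := exists_slice_le hR hx
  exact dens_ne_top hC hle y

theorem dens_slice_mul_le (hR : IsTP2Measure R) {x₁ x₂ : ℝ} (h₁ : x₁ ∈ xRange R \ xo R)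
    (h₂ : x₂ ∈ xRange R \ xo R) (hx : x₁ < x₂) {y₁ y₂ : ℝ} (hy : y₁ < y₂) :
    dens (slice R x₂) R.snd y₁ * dens (slice R x₁) R.snd y₂ ≤
      dens (slice R x₁) R.snd y₁ * dens (slice R x₂) R.snd y₂ := by
  -- Two points in the same gap share a next point and thus a slice; the inequality is then an
  -- equality.
  rcases (nextPoint_mono h₂.1 hx.le).eq_or_lt with h | h
  · have : slice R x₁ = slice R x₂ := by
      simp only [slice, h]
    rw [this]
  · refine dens_mul_le (dens_slice_ne_top hR h₁) (dens_slice_ne_top hR h₂) ?_ hy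
    intro B₁ B₂ m₁ m₂ hB
    simp only [slice_apply hR h₁ m₁, slice_apply hR h₁ m₂, slice_apply hR h₂ m₁,
      slice_apply hR h₂ m₂]
    exact hR.condLim_setLR h B₁ B₂ m₁ m₂ hB

theorem measurable_dens_slice (hR : IsTP2Measure R) {x : ℝ} (hx : x ∈ xRange R \ xo R) :
    Measurable (dens (slice R x) R.snd) := by
  obtain ⟨C, hC, hle⟩ := exists_slice_le hR hx
  set z := nextPoint R x
  set L : Measure ℝ := (R.restrict (Iic z ×ˢ univ)).snd
  set U : Measure ℝ := (R.restrict (Ici z ×ˢ univ)).snd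
  have ap : ∀ {A B : Set ℝ}, MeasurableSet B →
      (R.restrict (A ×ˢ univ)).snd B = R (A ×ˢ B) := by
    intro A B hB
    rw [Measure.snd_apply hB, Measure.restrict_apply (measurable_snd hB)]
    congr 1
    ext p
    simp [and_comm]
  have aq : ∀ {B : Set ℝ}, MeasurableSet B → R.snd B = R (univ ×ˢ B) := by
    intro B hB
    rw [Measure.snd_apply hB, Set.univ_prod]
  have hL : ∀ {B : Set ℝ}, MeasurableSet B → L B = R (Iic z ×ˢ B) := ap
  have hU : ∀ {B : Set ℝ}, MeasurableSet B → U B = R (Ici z ×ˢ B) := ap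
  refine measurable_dens (L := L) (U := U) hC hle (fun B hB => ?_) (fun B hB => ?_)
    (fun B hB => ?_) ?_ ?_ ?_ ?_
  · rw [hL hB]
    exact prod_le_snd R _ hB
  · rw [hU hB]
    exact prod_le_snd R _ hB
  · rw [hL hB, hU hB, aq hB, ← Iic_union_Ici (a := z), union_prod]
    exact measure_union_le _ _
  · intro B₁ B₂ m₁ m₂ hB
    simp only [hL m₁, hL m₂, aq m₁, aq m₂]
    have := hR.setLR_union (C := ∅) (I := Iic z) (D := Ioi z) .empty measurableSet_Iic
      measurableSet_Ioi (by simp [SetLT]) (fun a ha b hb => lt_of_le_of_lt ha hb) (by simp [SetLT])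
    rw [empty_union, Iic_union_Ioi] at this
    exact this B₁ B₂ m₁ m₂ hB
  · intro B₁ B₂ m₁ m₂ hB
    simp only [hU m₁, hU m₂, aq m₁, aq m₂]
    have := hR.setLR_union (C := Iio z) (I := Ici z) (D := ∅) measurableSet_Iio measurableSet_Ici
      .empty (fun a ha b hb => lt_of_lt_of_le ha hb) (by simp [SetLT]) (by simp [SetLT])
    rw [union_empty, Iio_union_Ici] at this
    exact this B₁ B₂ m₁ m₂ hB
  · intro B₁ B₂ m₁ m₂ hB
    simp only [hL m₁, hL m₂, slice_apply hR hx m₁, slice_apply hR hx m₂]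
    exact hR.setLR_Iic_condLim z B₁ B₂ m₁ m₂ hB
  · intro B₁ B₂ m₁ m₂ hB
    simp only [hU m₁, hU m₂, slice_apply hR hx m₁, slice_apply hR hx m₂]
    exact hR.setLR_condLim_Ici z B₁ B₂ m₁ m₂ hB

theorem withDensity_dens_slice (hR : IsTP2Measure R) {x : ℝ} (hx : x ∈ xRange R \ xo R) :
    R.snd.withDensity (dens (slice R x) R.snd) = slice R x := by
  obtain ⟨C, hC, hle⟩ := exists_slice_le hR hx
  have := isProbabilityMeasure_slice hR hx
  exact withDensity_dens hle

/-! ### Truncation to the interval between the boundary functions -/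

/-- The set of all real numbers between the southeast and the northwest boundary. -/
def window (R : Measure (ℝ × ℝ)) (x : ℝ) : Set ℝ := {y | se R x ≤ y ∧ (y : EReal) ≤ nw R x}

omit [IsProbabilityMeasure R] in
theorem measurableSet_window (x : ℝ) : MeasurableSet (window R x) :=
  measurable_coe_real_ereal measurableSet_Icc

/-- Were the window null, so would be its parts below and above `y`. The corresponding parts of the
two quadrants still have positive `R`-mass, so the comparisons with `Iic` and `Ici` kill the slice
below `se` and above `nw` too, leaving total mass zero. -/
theorem slice_window_ne_zero (hR : IsTP2Measure R) {x : ℝ} (hx : x ∈ xRange R \ xo R) :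
    slice R x (window R x) ≠ 0 := by
  obtain ⟨y, hy₁, hy₂⟩ := exists_between hx
  have := isProbabilityMeasure_slice hR hx
  intro h0
  have mA : MeasurableSet {t : ℝ | (t : EReal) < se R x} :=
    measurable_coe_real_ereal measurableSet_Iio
  have mD : MeasurableSet {t : ℝ | nw R x < (t : EReal)} :=
    measurable_coe_real_ereal measurableSet_Ioi
  have mA' : MeasurableSet {t : ℝ | se R x ≤ (t : EReal) ∧ t < y} :=
    (measurable_coe_real_ereal measurableSet_Ici).inter measurableSet_Iio
  have mD' : MeasurableSet {t : ℝ | (t : EReal) ≤ nw R x ∧ y < t} :=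
    (measurable_coe_real_ereal measurableSet_Iic).inter measurableSet_Ioi
  have wA' : slice R x {t : ℝ | se R x ≤ (t : EReal) ∧ t < y} = 0 :=
    measure_mono_null (fun t ht => by exact ⟨ht.1, (EReal.coe_lt_coe_iff.2 ht.2).le.trans hy₂.le⟩) h0
  have wD' : slice R x {t : ℝ | (t : EReal) ≤ nw R x ∧ y < t} = 0 :=
    measure_mono_null (fun t ht => by exact ⟨hy₁.le.trans (EReal.coe_lt_coe_iff.2 ht.2).le, ht.1⟩) h0
  have hA' : R (Ici (nextPoint R x) ×ˢ {t : ℝ | se R x ≤ (t : EReal) ∧ t < y}) ≠ 0 := by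
    refine measure_Ici_nextPoint_ne_zero fun hz => se_lt_iff.1 hy₁ ?_
    refine measure_mono_null (fun p hp => ?_) (measure_union_null hz (isGreatest_se R x).1)
    by_cases h : se R x ≤ (p.2 : EReal)
    · exact .inl ⟨hp.1, h, hp.2⟩
    · exact .inr ⟨hp.1, not_le.1 h⟩
  have hD' : R (Iic (nextPoint R x) ×ˢ {t : ℝ | (t : EReal) ≤ nw R x ∧ y < t}) ≠ 0 := by
    refine measure_Iic_nextPoint_ne_zero hx.1 fun hz => lt_nw_iff.1 hy₂ ?_
    refine measure_mono_null (fun p hp => ?_) (measure_union_null hz (isLeast_nw R x).1)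
    by_cases h : (p.2 : EReal) ≤ nw R x
    · exact .inl ⟨hp.1, h, hp.2⟩
    · exact .inr ⟨hp.1, not_le.1 h⟩
  have sA : slice R x {t : ℝ | (t : EReal) < se R x} = 0 := by
    have := hR.setLR_Iic_condLim (nextPoint R x) _ _ mA mD' fun a ha b hb =>
      EReal.coe_lt_coe_iff.1 (ha.trans (hy₁.trans (EReal.coe_lt_coe_iff.2 hb.2)))
    rw [← slice_apply hR hx mD', ← slice_apply hR hx mA, wD', mul_zero, nonpos_iff_eq_zero,
      mul_eq_zero] at this
    exact this.resolve_right hD'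
  have sD : slice R x {t : ℝ | nw R x < (t : EReal)} = 0 := by
    have := hR.setLR_condLim_Ici (nextPoint R x) _ _ mA' mD fun a ha b hb =>
      EReal.coe_lt_coe_iff.1 (((EReal.coe_lt_coe_iff.2 ha.2).trans hy₂).trans hb)
    rw [← slice_apply hR hx mD, ← slice_apply hR hx mA', wA', zero_mul, nonpos_iff_eq_zero,
      mul_eq_zero] at this
    exact this.resolve_left hA'
  have : slice R x univ = 0 := by
    refine measure_mono_null (fun t _ => ?_) (measure_union_null h0 (measure_union_null sA sD))
    by_cases h₁ : se R x ≤ (t : EReal)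
    · by_cases h₂ : (t : EReal) ≤ nw R x
      · exact .inl ⟨h₁, h₂⟩
      · exact .inr (.inr (not_le.1 h₂))
    · exact .inr (.inl (not_le.1 h₁))
  simp at this

/-- The density of the truncated and normalized slice at `x`. -/
noncomputable def sliceDensity (R : Measure (ℝ × ℝ)) (x : ℝ) : ℝ → ℝ≥0∞ :=
  (slice R x (window R x))⁻¹ • (window R x).indicator (dens (slice R x) R.snd)

theorem measurable_sliceDensity (hR : IsTP2Measure R) {x : ℝ} (hx : x ∈ xRange R \ xo R) :
    Measurable (sliceDensity R x) :=
  ((measurable_dens_slice hR hx).indicator (measurableSet_window x)).const_smul _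

theorem exists_sliceDensity_le (hR : IsTP2Measure R) {x : ℝ} (hx : x ∈ xRange R \ xo R) :
    ∃ C : ℝ≥0∞, C ≠ ∞ ∧ ∀ y, sliceDensity R x y ≤ C := by
  obtain ⟨C, hC, hle⟩ := exists_slice_le hR hx
  refine ⟨(slice R x (window R x))⁻¹ * C,
    ENNReal.mul_ne_top (ENNReal.inv_ne_top.2 (slice_window_ne_zero hR hx)) hC, fun y => ?_⟩
  simp only [sliceDensity, Pi.smul_apply, smul_eq_mul]
  gcongr
  exact (indicator_le_self' (fun _ _ => zero_le) y).trans (dens_le hle y)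

theorem sliceDensity_ne_top (hR : IsTP2Measure R) {x : ℝ} (hx : x ∈ xRange R \ xo R) (y : ℝ) :
    sliceDensity R x y ≠ ∞ := by
  obtain ⟨C, hC, hle⟩ := exists_sliceDensity_le hR hx
  exact ((hle y).trans_lt hC.lt_top).ne

omit [IsProbabilityMeasure R] in
theorem sliceDensity_eq_zero {x y : ℝ} (hy : y ∉ window R x) : sliceDensity R x y = 0 := by
  simp [sliceDensity, hy]

theorem sliceDensity_mul_le (hR : IsTP2Measure R) {x₁ x₂ : ℝ} (h₁ : x₁ ∈ xRange R \ xo R)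
    (h₂ : x₂ ∈ xRange R \ xo R) (hx : x₁ < x₂) {y₁ y₂ : ℝ} (hy : y₁ < y₂) :
    sliceDensity R x₂ y₁ * sliceDensity R x₁ y₂ ≤
      sliceDensity R x₁ y₁ * sliceDensity R x₂ y₂ := by
  by_cases hw₁ : y₁ ∈ window R x₂
  swap
  · simp [sliceDensity_eq_zero hw₁]
  by_cases hw₂ : y₂ ∈ window R x₁
  swap
  · simp [sliceDensity_eq_zero hw₂]
  have hy' := (EReal.coe_lt_coe_iff.2 hy).le
  -- If the left side is nonzero, monotone boundaries put both `y`-values in both windows.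
  have hw₃ : y₁ ∈ window R x₁ := ⟨(se_mono hx.le).trans hw₁.1, hy'.trans hw₂.2⟩
  have hw₄ : y₂ ∈ window R x₂ := ⟨hw₁.1.trans hy', hw₂.2.trans (nw_mono hx.le)⟩
  simp only [sliceDensity, Pi.smul_apply, smul_eq_mul, indicator_of_mem, hw₁, hw₂, hw₃, hw₄]
  set c₁ := (slice R x₁ (window R x₁))⁻¹
  set c₂ := (slice R x₂ (window R x₂))⁻¹
  calc _ = c₁ * c₂ * (dens (slice R x₂) R.snd y₁ * dens (slice R x₁) R.snd y₂) := by ring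
    _ ≤ c₁ * c₂ * (dens (slice R x₁) R.snd y₁ * dens (slice R x₂) R.snd y₂) := by
        gcongr _ * ?_
        exact dens_slice_mul_le hR h₁ h₂ hx hy
    _ = _ := by ring

theorem withDensity_sliceDensity (hR : IsTP2Measure R) {x : ℝ} (hx : x ∈ xRange R \ xo R) :
    R.snd.withDensity (sliceDensity R x) = (slice R x)[|window R x] := by
  rw [sliceDensity, withDensity_smul' _ _ (ENNReal.inv_ne_top.2 (slice_window_ne_zero hR hx)),
    withDensity_indicator (measurableSet_window x), ← restrict_withDensity (measurableSet_window x),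
    withDensity_dens_slice hR hx, ProbabilityTheory.cond]

/-- Rational half-lines form a countable determining class, so one null set suffices; almost every
`x` is in the support and is its own next point. -/
theorem ae_slice_eq_condKernel (hR : IsTP2Measure R) :
    ∀ᵐ x ∂ R.fst, x ∈ xRange R \ xo R → slice R x = R.condKernel x := by
  have h := ae_all_iff.2 fun q : ℚ => ae_condLim_eq_condKernel R (measurableSet_Iic (a := (q : ℝ)))
  filter_upwards [h, Measure.support_mem_ae (μ := R.fst)] with x hx hs hxo
  have := isProbabilityMeasure_slice hR hxo
  refine ext_of_generate_finite _ Real.borel_eq_generateFrom_Iic_rat Real.isPiSystem_Iic_rat ?_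
    (by simp)
  intro s hs'
  obtain ⟨q, hq⟩ := mem_iUnion.1 hs'
  rw [mem_singleton_iff.1 hq, slice_apply hR hxo measurableSet_Iic, nextPoint_eq_self hs]
  exact hx q

end Slice

/-! ### The stochastic kernel -/

section Kernel

variable {R : Measure (ℝ × ℝ)}

open Classical in
/-- The conditional laws: Dirac measures on `xo R`, truncated slices on the rest of the range. -/
noncomputable def condLaw (R : Measure (ℝ × ℝ)) (S : xo R → ℝ) (x : ℝ) : Measure ℝ :=
  if h : x ∈ xo R then Measure.dirac (S ⟨x, h⟩)
  else if x ∈ xRange R then R.snd.withDensity (sliceDensity R x) else Measure.dirac 0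

variable {S : xo R → ℝ}

theorem condLaw_of_mem_xo {x : ℝ} (hx : x ∈ xo R) :
    condLaw R S x = Measure.dirac (S ⟨x, hx⟩) := by
  simp [condLaw, hx]

theorem condLaw_of_mem_diff {x : ℝ} (hx : x ∈ xRange R \ xo R) :
    condLaw R S x = R.snd.withDensity (sliceDensity R x) := by
  simp [condLaw, hx.1, hx.2]

/-- The range has full mass, so this default value only keeps the kernel Markov. -/
theorem condLaw_of_notMem {x : ℝ} (hx : x ∉ xRange R) : condLaw R S x = Measure.dirac 0 := by
  have : x ∉ xo R := fun h => hx h.1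
  simp [condLaw, hx, this]

variable [IsProbabilityMeasure R]

theorem isProbabilityMeasure_condLaw (hR : IsTP2Measure R) (x : ℝ) :
    IsProbabilityMeasure (condLaw R S x) := by
  by_cases hx : x ∈ xRange R
  · by_cases hxo : x ∈ xo R
    · rw [condLaw_of_mem_xo hxo]
      infer_instance
    · rw [condLaw_of_mem_diff ⟨hx, hxo⟩, withDensity_sliceDensity hR ⟨hx, hxo⟩]
      have := isProbabilityMeasure_slice hR ⟨hx, hxo⟩
      exact cond_isProbabilityMeasure (slice_window_ne_zero hR ⟨hx, hxo⟩)
  · rw [condLaw_of_notMem hx]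
    infer_instance

omit [IsProbabilityMeasure R] in
theorem condLaw_compl_window {x : ℝ} (hx : x ∈ xRange R \ xo R) {B : Set ℝ}
    (hB : MeasurableSet B) (h : Disjoint B (window R x)) : condLaw R S x B = 0 := by
  rw [condLaw_of_mem_diff hx, withDensity_apply _ hB]
  exact setLIntegral_eq_zero hB fun y hy => sliceDensity_eq_zero (Set.disjoint_left.1 h hy)

theorem lrLe_condLaw (hR : IsTP2Measure R) (hS : IsIsotonicSelection R S) {x₁ x₂ : ℝ}
    (h₁ : x₁ ∈ xRange R) (h₂ : x₂ ∈ xRange R) (hx : x₁ < x₂) :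
    LRLe (condLaw R S x₁) (condLaw R S x₂) := by
  have i₁ := isProbabilityMeasure_condLaw (S := S) hR x₁
  have i₂ := isProbabilityMeasure_condLaw (S := S) hR x₂
  by_cases o₁ : x₁ ∈ xo R
  · rw [condLaw_of_mem_xo o₁]
    refine lrLe_dirac_left ?_
    by_cases o₂ : x₂ ∈ xo R
    · rw [condLaw_of_mem_xo o₂]
      simpa using hS.1 (show (⟨x₁, o₁⟩ : xo R) ≤ ⟨x₂, o₂⟩ from hx.le)
    · refine condLaw_compl_window ⟨h₂, o₂⟩ measurableSet_Iio (Set.disjoint_left.2 fun y hy hw => ?_)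
      -- `S x₁ ≤ se x₁ ≤ se x₂`, so the window at `x₂` lies above the point mass.
      exact not_lt.2 (((hS.2 ⟨x₁, o₁⟩).2.trans (se_mono hx.le)).trans hw.1)
        (EReal.coe_lt_coe_iff.2 hy)
  · by_cases o₂ : x₂ ∈ xo R
    · rw [condLaw_of_mem_xo o₂]
      refine lrLe_dirac_right ?_
      refine condLaw_compl_window ⟨h₁, o₁⟩ measurableSet_Ioi (Set.disjoint_left.2 fun y hy hw => ?_)
      exact not_lt.2 ((hw.2.trans (nw_mono hx.le)).trans (hS.2 ⟨x₂, o₂⟩).1)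
        (EReal.coe_lt_coe_iff.2 hy)
    · rw [condLaw_of_mem_diff ⟨h₁, o₁⟩, condLaw_of_mem_diff ⟨h₂, o₂⟩]
      exact lrLe_withDensity (measurable_sliceDensity hR ⟨h₁, o₁⟩)
        (measurable_sliceDensity hR ⟨h₂, o₂⟩) (sliceDensity_ne_top hR ⟨h₁, o₁⟩)
        (sliceDensity_ne_top hR ⟨h₂, o₂⟩)
        fun y₁ y₂ hy => sliceDensity_mul_le hR ⟨h₁, o₁⟩ ⟨h₂, o₂⟩ hx hy

theorem measurable_condLaw (hR : IsTP2Measure R) (hS : IsIsotonicSelection R S) :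
    Measurable (condLaw R S) := by
  have := isProbabilityMeasure_condLaw (S := S) hR
  refine Measurable.measure_of_isPiSystem_of_isProbabilityMeasure
    (borel_eq_generateFrom_Iic ℝ ▸ BorelSpace.measurable_eq) isPiSystem_Iic ?_
  rintro _ ⟨y, rfl⟩
  -- The range is an interval, and on it stochastic order makes `x ↦ condLaw R S x (Iic y)`
  -- antitone.
  refine measurable_of_restrict_of_restrict_compl (s := xRange R) ordConnected_xRange.measurableSet
    (measurable_of_antitoneOn fun a ha b hb hab => ?_) ?_
  · rcases hab.eq_or_lt with rfl | hab
    · exact le_rfl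
    · exact (lrLe_condLaw hR hS ha hb hab).measure_Iic_le y
  · have : (xRange R)ᶜ.domRestrict (fun x => condLaw R S x (Iic y)) =
        fun _ => Measure.dirac (0 : ℝ) (Iic y) := by
      funext x
      show condLaw R S x (Iic y) = _
      rw [condLaw_of_notMem x.2]
    rw [this]
    exact measurable_const

theorem eq_dirac_of_ae_eq {ν : Measure ℝ} [IsProbabilityMeasure ν] {a : ℝ}
    (h : ∀ᵐ y ∂ν, y = a) : ν = Measure.dirac a := by
  have : ν.map id = ν.map fun _ => a := Measure.map_congr (β := ℝ) (μ := ν) (f := (id : ℝ → ℝ)) (g := fun _ => a) h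
  simpa [Measure.map_const] using this

omit [IsProbabilityMeasure R] in
theorem ae_mem_xRange : ∀ᵐ x ∂ R.fst, x ∈ xRange R :=
  (ae_map_iff measurable_fst.aemeasurable ordConnected_xRange.measurableSet).2 ae_fst_mem_xRange

theorem condLaw_ae_eq_condKernel (hR : IsTP2Measure R) (hS : IsIsotonicSelection R S) :
    ∀ᵐ x ∂ R.fst, condLaw R S x = R.condKernel x := by
  have hw : ∀ᵐ p ∂ (R.fst ⊗ₘ R.condKernel), p.2 ∈ window R p.1 := by
    rw [R.disintegrate R.condKernel]
    filter_upwards [ae_le_nw, ae_se_le] with p h₁ h₂ using ⟨h₂, h₁⟩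
  filter_upwards [ae_mem_xRange, ae_slice_eq_condKernel hR, Measure.ae_ae_of_ae_compProd hw]
    with x hx hs hwx
  by_cases hxo : x ∈ xo R
  · rw [condLaw_of_mem_xo hxo]
    refine (eq_dirac_of_ae_eq ?_).symm
    filter_upwards [hwx] with y hy
    have := hS.2 ⟨x, hxo⟩
    -- `y ≤ nw ≤ S ≤ se ≤ y` forces `y = S x`.
    exact EReal.coe_injective (le_antisymm (hy.2.trans this.1) (this.2.trans hy.1))
  · have hx' : x ∈ xRange R \ xo R := ⟨hx, hxo⟩
    -- For almost every `x` the window has full conditional mass, so conditioning on it changes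
    -- nothing.
    rw [condLaw_of_mem_diff hx', withDensity_sliceDensity hR hx', hs hx', ProbabilityTheory.cond,
      Measure.restrict_eq_self_of_ae_mem hwx, (mem_ae_iff_prob_eq_one (measurableSet_window x)).1 hwx, inv_one, one_smul]

end Kernel

end TP2Law

theorem mainTheorem4 (R : Measure (ℝ × ℝ)) [IsProbabilityMeasure R]
    (hR : TP2Law.IsTP2Measure R) :
    (∃ S : TP2Law.xo R → ℝ, TP2Law.IsIsotonicSelection R S) ∧
    ∀ S : TP2Law.xo R → ℝ, TP2Law.IsIsotonicSelection R S →
      ∃ K : Kernel ℝ ℝ, IsMarkovKernel K ∧ R.IsCondKernel K ∧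
        (∀ x₁ ∈ TP2Law.xRange R, ∀ x₂ ∈ TP2Law.xRange R, x₁ < x₂ →
          TP2Law.LRLe (K x₁) (K x₂)) ∧
        (∀ x : TP2Law.xo R, K (x : ℝ) = Measure.dirac (S x)) ∧
        ∃ h : ℝ → ℝ → ℝ,
          (∀ x ∈ TP2Law.xRange R \ TP2Law.xo R,
            Measurable (h x) ∧ (∀ y, 0 ≤ h x y) ∧ (∃ C : ℝ, ∀ y, h x y ≤ C) ∧
            K x = R.snd.withDensity (fun y => ENNReal.ofReal (h x y)) ∧
            ∀ y : ℝ, ((y : EReal) < TP2Law.se R x ∨ TP2Law.nw R x < (y : EReal)) → h x y = 0) ∧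
          TP2Law.IsTP2On (TP2Law.xRange R \ TP2Law.xo R) h := by
  refine ⟨TP2Law.exists_isIsotonicSelection, fun S hS => ?_⟩
  set K : Kernel ℝ ℝ := ⟨TP2Law.condLaw R S, TP2Law.measurable_condLaw hR hS⟩
  have hK : IsMarkovKernel K := ⟨TP2Law.isProbabilityMeasure_condLaw hR⟩
  refine ⟨K, hK, ⟨?_⟩, fun x₁ h₁ x₂ h₂ hx => TP2Law.lrLe_condLaw hR hS h₁ h₂ hx,
    fun x => TP2Law.condLaw_of_mem_xo x.2, fun x y => (TP2Law.sliceDensity R x y).toReal,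
    fun x hx => ⟨?_, fun y => ENNReal.toReal_nonneg, ?_, ?_, ?_⟩, ?_⟩
  -- Disintegration only sees the kernel up to null sets of the first marginal.
  · rw [Measure.compProd_congr (μ := R.fst) (κ := K) (η := R.condKernel)
       (TP2Law.condLaw_ae_eq_condKernel hR hS)]
    exact R.disintegrate R.condKernel
  · exact (TP2Law.measurable_sliceDensity hR hx).ennreal_toReal
  · obtain ⟨C, hC, hle⟩ := TP2Law.exists_sliceDensity_le hR hx
    exact ⟨C.toReal, fun y => ENNReal.toReal_mono hC (hle y)⟩
  · simp only [ENNReal.ofReal_toReal (TP2Law.sliceDensity_ne_top hR hx _)]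
    exact TP2Law.condLaw_of_mem_diff hx
  · intro y hy
    have : y ∉ TP2Law.window R x := fun hw =>
      hy.elim (fun h => not_lt.2 hw.1 h) fun h => not_lt.2 hw.2 h
    simp [TP2Law.sliceDensity_eq_zero this]
  · intro x₁ h₁ x₂ h₂ hx y₁ y₂ hy
    rw [← ENNReal.toReal_mul, ← ENNReal.toReal_mul]
    exact ENNReal.toReal_mono (ENNReal.mul_ne_top (TP2Law.sliceDensity_ne_top hR h₁ _)
      (TP2Law.sliceDensity_ne_top hR h₂ _)) (TP2Law.sliceDensity_mul_le hR h₁ h₂ hx hy)
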